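/- Let $d\ge 1$. Let $\mathcal H=\{s\in\mathbb R^d:\ \sum_{i=1}^d s_i=1\}$, let $\Delta^{d-1}=\{s\in\mathcal H:\ s_i\ge 0 \text{ for all } i\}$ be the standard simplex, and let $$\mathcal E=\Bigl\{s\in\mathbb R^d:\ \sum_{i=1}^d s_i=1,\ \sum_{i=1}^d s_i^2\le 1\Bigr\}.$$ An ellipsoid in $\mathcal H$ is a set $c+T(B)$, where $c\in\mathcal H$, $B$ is the closed Euclidean unit ball of the linear space $\mathcal H_0=\{v\in\mathbb R^d:\ \sum_{i=1}^d v_i=0\}$, and $T:\mathcal H_0\to\mathcal H_0$ is linear and invertible. Then $\mathcal E$ is the unique minimum-volume covering ellipsoid of $\Delta^{d-1}$ in $\mathcal H$: $\mathcal E$ is an ellipsoid in $\mathcal H$ with $\Delta^{d-1}\subseteq\mathcal E$; every ellipsoid $F$ in $\mathcal H$ with $\Delta^{d-1}\subseteq F$ has $(d-1)$-dimensional Euclidean volume at least that of $\mathcal E$; and equality holds only if $F=\mathcal E$. -/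

import Mathlib

open MeasureTheory

/-- An ellipsoid of an affine subspace `H` of a Euclidean space: the image of the closed unit ball
of the direction space of `H` under an invertible affine map onto `H`, i.e. a set `c + T(B)` with
centre `c ∈ H` and `T` an invertible linear map of the direction space of `H`. It has the full
dimension of `H`. -/
def IsEllipsoidIn {V : Type*} [NormedAddCommGroup V] [InnerProductSpace ℝ V]
    (H : AffineSubspace ℝ V) (E : Set V) : Prop :=
  ∃ c ∈ H, ∃ T : H.direction ≃ₗ[ℝ] H.direction,
    E = (fun v : H.direction => c + (T v : V)) '' Metric.closedBall (0 : H.direction) 1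

/-- The volume of a subset of an affine subspace `H`: the `dim H`-dimensional Euclidean volume
(Hausdorff measure of dimension `dim H`, normalised to agree with Lebesgue measure). -/
noncomputable def volumeIn {V : Type*} [NormedAddCommGroup V] [InnerProductSpace ℝ V]
    [MeasurableSpace V] [BorelSpace V] (H : AffineSubspace ℝ V) (E : Set V) : ENNReal :=
  μHE[Module.finrank ℝ H.direction] E

/-- `E` is an ellipsoid of `H` that contains `K`. -/
def IsCoveringEllipsoid {V : Type*} [NormedAddCommGroup V] [InnerProductSpace ℝ V]
    (H : AffineSubspace ℝ V) (K E : Set V) : Prop :=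
  IsEllipsoidIn H E ∧ K ⊆ E

/-- `E` has the least volume among all ellipsoids of `H` that contain `K`. -/
def IsMinVolumeCoveringEllipsoid {V : Type*} [NormedAddCommGroup V] [InnerProductSpace ℝ V]
    [MeasurableSpace V] [BorelSpace V] (H : AffineSubspace ℝ V) (K E : Set V) : Prop :=
  IsCoveringEllipsoid H K E ∧
    ∀ F : Set V, IsCoveringEllipsoid H K F → volumeIn H E ≤ volumeIn H F

/-- The hyperplane `∑ i, s i = 1` of `ℝ^d`. -/
def sumOneHyperplane (d : ℕ) : AffineSubspace ℝ (EuclideanSpace ℝ (Fin d)) where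
  carrier := {s | ∑ i, s i = 1}
  smul_vsub_vadd_mem' := by
    intro c p₁ p₂ p₃ h₁ h₂ h₃
    simp only [Set.mem_ofPred_eq] at h₁ h₂ h₃ ⊢
    simp [Finset.sum_add_distrib, ← Finset.mul_sum, h₁, h₂, h₃]

/-- The standard simplex of `ℝ^d`, of dimension `d - 1`, in the Euclidean space `ℝ^d`. -/
def euclideanStdSimplex (d : ℕ) : Set (EuclideanSpace ℝ (Fin d)) :=
  {s | (∀ i, 0 ≤ s i) ∧ ∑ i, s i = 1}

/-- The set of all `s ∈ ℝ^d` with `∑ i, s i = 1` and `∑ i, (s i) ^ 2 ≤ 1`. -/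
def simplexOuterEllipsoid (d : ℕ) : Set (EuclideanSpace ℝ (Fin d)) :=
  {s | ∑ i, s i = 1 ∧ ∑ i, (s i) ^ 2 ≤ 1}

/-!
Let `b` be the barycentre of the simplex, `U` the direction of the hyperplane, `n = d - 1` its
dimension, and `r = √((d - 1) / d)`. The outer ellipsoid is `b + r B`, and an ellipsoid `c + T(B)`
has volume `|det T| vol B` (`volumeIn_image_closedBall`).

Suppose that `c + T(B)` contains the vertices `eᵢ`, that is, `‖T⁻¹ (eᵢ - c)‖ ≤ 1`. The vectors
`eᵢ - b` sum to zero and are the projections of the standard basis to `U`, so summing the squares of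
these inequalities gives `tr (T⁻¹† T⁻¹) + d ‖T⁻¹ (b - c)‖² ≤ d` (`trace_add_norm_sq_le`). For
`S = r T⁻¹` this reads `tr (S† S) ≤ n (1 - ‖T⁻¹ (b - c)‖²)`, since `d r² = n`. If the volume of
`c + T(B)` is at most that of the outer ellipsoid, then `|det S| ≥ 1`, so the eigenvalues of `S† S`
have sum at most `n` and product at least `1`. By the equality case of the arithmetic-geometric mean
inequality they all equal `1` (`LinearMap.adjoint_comp_self_eq_id_of_trace_le`). Hence `S` is an
isometry and `c = b`, so `c + T(B) = b + r B`
(`eq_simplexOuterEllipsoid_of_volumeIn_le`). Minimality and uniqueness both follow. For `d = 1`,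
where `r = 0`, the hyperplane is a single point.
-/

/-! ### The arithmetic-geometric mean inequality -/

/-- Equality case of the inequality of arithmetic and geometric means, normalised at `1`. -/
lemma eq_one_of_sum_le_card_of_one_le_prod {ι : Type*} [Fintype ι] (x : ι → ℝ)
    (hx : ∀ i, 0 ≤ x i) (hsum : ∑ i, x i ≤ Fintype.card ι) (hprod : 1 ≤ ∏ i, x i) (i : ι) :
    x i = 1 := by
  have hne : ∀ j, x j ≠ 0 := fun j hj => by
    rw [Finset.prod_eq_zero (Finset.mem_univ j) hj] at hprod
    linarith
  have hpos : ∀ j, 0 < x j := fun j => lt_of_le_of_ne (hx j) (hne j).symm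
  have hlog : 0 ≤ ∑ j, Real.log (x j) := by
    rw [← Real.log_prod fun j _ => hne j]
    exact Real.log_nonneg hprod
  -- Summing `log x ≤ x - 1` leaves no room for a strict inequality in any term.
  by_contra hi
  have hlt : ∑ j, Real.log (x j) < ∑ j, (x j - 1) :=
    Finset.sum_lt_sum (fun j _ => Real.log_le_sub_one_of_pos (hpos j))
      ⟨i, Finset.mem_univ i, Real.log_lt_sub_one_of_pos (hpos i) hi⟩
  simp only [Finset.sum_sub_distrib, Finset.sum_const, Finset.card_univ, nsmul_eq_mul,
    mul_one] at hlt
  linarith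

/-! ### Trace, determinant and isometries -/

section

variable {U : Type*} [NormedAddCommGroup U] [InnerProductSpace ℝ U] [FiniteDimensional ℝ U]

/-- The equality case of the arithmetic-geometric mean inequality, applied to the eigenvalues of
`S† ∘ S`. -/
lemma LinearMap.adjoint_comp_self_eq_id_of_trace_le (S : U →ₗ[ℝ] U)
    (htr : LinearMap.trace ℝ U (S.adjoint ∘ₗ S) ≤ Module.finrank ℝ U)
    (hdet : 1 ≤ |LinearMap.det S|) : S.adjoint ∘ₗ S = LinearMap.id := by
  have hpos := LinearMap.isPositive_adjoint_comp_self S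
  have hsymm := hpos.isSymmetric
  have hone : ∀ i, hsymm.eigenvalues rfl i = 1 := by
    refine eq_one_of_sum_le_card_of_one_le_prod _ (hpos.nonneg_eigenvalues rfl) ?_ ?_
    · rw [hsymm.trace_eq_sum_eigenvalues rfl] at htr
      simpa using htr
    · have hprod := hsymm.det_eq_prod_eigenvalues rfl
      rw [← S.normDet_sq, S.normDet_eq_abs_det] at hprod
      have hprod' : |LinearMap.det S| ^ 2 = ∏ i, hsymm.eigenvalues rfl i := by
        simpa using hprod
      rw [← hprod']
      exact one_le_pow₀ hdet
  refine (hsymm.eigenvectorBasis rfl).toBasis.ext fun i => ?_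
  simp [hone i]

lemma LinearMap.norm_apply_eq_of_adjoint_comp_self_eq_id {S : U →ₗ[ℝ] U}
    (hS : S.adjoint ∘ₗ S = LinearMap.id) (v : U) : ‖S v‖ = ‖v‖ := by
  rw [← sq_eq_sq₀ (norm_nonneg _) (norm_nonneg _), ← real_inner_self_eq_norm_sq,
    ← real_inner_self_eq_norm_sq, ← LinearMap.adjoint_inner_right, ← LinearMap.comp_apply, hS,
    LinearMap.id_apply]

/-- Rigidity of the extremal case: the normalised inverse `r • T⁻¹` satisfies the hypotheses of
`LinearMap.adjoint_comp_self_eq_id_of_trace_le`, so it is an isometry; its trace then exhausts the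
bound, which leaves no room for the offset `z`. -/
lemma eq_zero_and_norm_smul_symm_apply_eq (T : U ≃ₗ[ℝ] U) {r a : ℝ} {z : U} (hr : 0 < r)
    (ha : 0 < a) (har : a * r ^ 2 = Module.finrank ℝ U)
    (hdet : |LinearMap.det T.toLinearMap| ≤ |LinearMap.det (r • LinearMap.id : U →ₗ[ℝ] U)|)
    (htr : LinearMap.trace ℝ U (T.symm.toLinearMap.adjoint ∘ₗ T.symm.toLinearMap) +
      a * ‖T.symm z‖ ^ 2 ≤ a) :
    z = 0 ∧ ∀ v, ‖r • T.symm v‖ = ‖v‖ := by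
  set S : U →ₗ[ℝ] U := r • T.symm.toLinearMap with hS
  have htrS : LinearMap.trace ℝ U (S.adjoint ∘ₗ S) =
      r ^ 2 * LinearMap.trace ℝ U (T.symm.toLinearMap.adjoint ∘ₗ T.symm.toLinearMap) := by
    rw [hS, map_smulₛₗ, LinearMap.smul_comp, LinearMap.comp_smul, smul_smul, map_smul]
    simp [sq]
  have hz0 : 0 ≤ a * ‖T.symm z‖ ^ 2 := by positivity
  have hr2 : 0 < r ^ 2 := by positivity
  have hmul := mul_le_mul_of_nonneg_left htr hr2.le
  have hSS : S.adjoint ∘ₗ S = LinearMap.id := by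
    refine S.adjoint_comp_self_eq_id_of_trace_le ?_ ?_
    · rw [htrS, ← har]
      nlinarith
    · have hST : S ∘ₗ T.toLinearMap = r • LinearMap.id := by
        ext1 v
        simp [hS]
      have hTpos : 0 < |LinearMap.det T.toLinearMap| :=
        abs_pos.2 (LinearEquiv.isUnit_det' T).ne_zero
      rw [← hST, LinearMap.det_comp, abs_mul] at hdet
      exact le_of_mul_le_mul_right (by rwa [one_mul]) hTpos
  refine ⟨?_, LinearMap.norm_apply_eq_of_adjoint_comp_self_eq_id hSS⟩
  rw [hSS, LinearMap.trace_id, ← har] at htrS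
  have h : a * ‖T.symm z‖ ^ 2 = 0 := by
    refine le_antisymm (nonpos_of_mul_nonpos_right (?_ : r ^ 2 * _ ≤ 0) hr2) hz0
    linarith
  simpa [ha.ne'] using h

end

/-! ### Parseval frames and volumes of ellipsoids -/

section

variable {V : Type*} [NormedAddCommGroup V] [InnerProductSpace ℝ V]

/-- The projections of an orthonormal basis onto a subspace form a Parseval frame, so they compute
the squared Hilbert-Schmidt norm of an endomorphism of that subspace. -/
lemma sum_norm_sq_apply_orthogonalProjection_eq_trace [FiniteDimensional ℝ V]
    {ι : Type*} [Fintype ι]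
    (b : OrthonormalBasis ι ℝ V) (U : Submodule ℝ V) (S : U →ₗ[ℝ] U) :
    ∑ i, ‖S (U.orthogonalProjectionOnto (b i))‖ ^ 2 =
      LinearMap.trace ℝ U (S.adjoint ∘ₗ S) := by
  have hcomp : S.adjoint ∘ₗ S = (U.orthogonalProjectionOnto : V →ₗ[ℝ] U) ∘ₗ
      (U.subtype ∘ₗ (S.adjoint ∘ₗ S)) := by
    ext v
    simp
  rw [hcomp, LinearMap.trace_comp_comm', LinearMap.trace_eq_sum_inner _ b]
  refine Finset.sum_congr rfl fun i _ => ?_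
  have h (w : U) : inner ℝ (b i) (w : V) = inner ℝ (U.orthogonalProjectionOnto (b i)) w := by
    simp
  simp only [LinearMap.comp_apply, Submodule.subtype_apply, ContinuousLinearMap.coe_coe]
  rw [h, LinearMap.adjoint_inner_right, real_inner_self_eq_norm_sq]

lemma volumeIn_image_closedBall [MeasurableSpace V] [BorelSpace V] (H : AffineSubspace ℝ V)
    [FiniteDimensional ℝ H.direction] (c : V) (T : H.direction →ₗ[ℝ] H.direction) :
    volumeIn H ((fun v : H.direction => c + (T v : V)) '' Metric.closedBall (0 : H.direction) 1) =
      ENNReal.ofReal |LinearMap.det T| *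
        volume (Metric.closedBall (0 : H.direction) 1) := by
  have hiso : Isometry fun v : H.direction => c + (v : V) :=
    (isometry_add_left c).comp isometry_subtype_coe
  have himage : (fun v : H.direction => c + (T v : V)) '' Metric.closedBall (0 : H.direction) 1 =
      (fun v : H.direction => c + (v : V)) '' (T '' Metric.closedBall (0 : H.direction) 1) := by
    rw [Set.image_image]
  rw [volumeIn, himage, hiso.euclideanHausdorffMeasure_image,
    T.euclideanHausdorffMeasure_image_eq_normDet_mul_volume, T.normDet_eq_abs_det]

lemma volumeIn_image_closedBall_le_iff [MeasurableSpace V] [BorelSpace V]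
    (H : AffineSubspace ℝ V) [FiniteDimensional ℝ H.direction] (c c' : V)
    (T T' : H.direction →ₗ[ℝ] H.direction) :
    volumeIn H ((fun v : H.direction => c + (T v : V)) '' Metric.closedBall 0 1) ≤
        volumeIn H ((fun v : H.direction => c' + (T' v : V)) '' Metric.closedBall 0 1) ↔
      |LinearMap.det T| ≤ |LinearMap.det T'| := by
  rw [volumeIn_image_closedBall, volumeIn_image_closedBall,
    ENNReal.mul_le_mul_iff_left (Metric.measure_closedBall_pos volume _ one_pos).ne'
      measure_closedBall_lt_top.ne, ENNReal.ofReal_le_ofReal_iff (abs_nonneg _)]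

lemma IsEllipsoidIn.subset {H : AffineSubspace ℝ V} {E : Set V} (hE : IsEllipsoidIn H E) :
    E ⊆ H := by
  obtain ⟨c, hc, T, rfl⟩ := hE
  rintro _ ⟨v, -, rfl⟩
  dsimp only
  rw [add_comm]
  exact AffineSubspace.vadd_mem_of_mem_direction (T v).2 hc

end

/-! ### Geometry of the simplex and its outer ellipsoid -/

/-- The barycentre of the standard simplex. -/
noncomputable def simplexBarycenter (d : ℕ) : EuclideanSpace ℝ (Fin d) :=
  WithLp.toLp 2 fun _ => (d : ℝ)⁻¹

lemma mem_sumOneHyperplane {d : ℕ} {s : EuclideanSpace ℝ (Fin d)} :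
    s ∈ sumOneHyperplane d ↔ ∑ i, s i = 1 :=
  Iff.rfl

lemma simplexBarycenter_mem {d : ℕ} (hd : d ≠ 0) : simplexBarycenter d ∈ sumOneHyperplane d := by
  simp [mem_sumOneHyperplane, simplexBarycenter, hd]

lemma mem_direction_sumOneHyperplane {d : ℕ} (hd : d ≠ 0) {v : EuclideanSpace ℝ (Fin d)} :
    v ∈ (sumOneHyperplane d).direction ↔ ∑ i, v i = 0 := by
  rw [← AffineSubspace.vadd_mem_iff_mem_direction v (simplexBarycenter_mem hd),
    mem_sumOneHyperplane]
  simp [Finset.sum_add_distrib, simplexBarycenter, hd]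

lemma direction_sumOneHyperplane {d : ℕ} (hd : d ≠ 0) :
    (sumOneHyperplane d).direction = (ℝ ∙ simplexBarycenter d)ᗮ := by
  ext v
  rw [mem_direction_sumOneHyperplane hd, Submodule.mem_orthogonal_singleton_iff_inner_right]
  simp [PiLp.inner_apply, simplexBarycenter, ← Finset.sum_mul, hd]

lemma finrank_direction_sumOneHyperplane {d : ℕ} (hd : d ≠ 0) :
    (Module.finrank ℝ (sumOneHyperplane d).direction : ℝ) = d - 1 := by
  have hne : simplexBarycenter d ≠ 0 := fun h => by
    have := mem_sumOneHyperplane.1 (simplexBarycenter_mem hd)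
    simp [h] at this
  have h := (ℝ ∙ simplexBarycenter d).finrank_add_finrank_orthogonal
  rw [finrank_span_singleton hne, ← direction_sumOneHyperplane hd, finrank_euclideanSpace_fin] at h
  rw [eq_sub_iff_add_eq, add_comm]
  exact_mod_cast h

lemma orthogonalProjection_single_eq {d : ℕ} (hd : d ≠ 0) (i : Fin d) :
    ((sumOneHyperplane d).direction.orthogonalProjectionOnto (EuclideanSpace.single i 1) :
      EuclideanSpace ℝ (Fin d)) = EuclideanSpace.single i 1 - simplexBarycenter d := by
  refine Submodule.eq_starProjection_of_mem_of_inner_eq_zero ?_ fun w hw => ?_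
  · rw [mem_direction_sumOneHyperplane hd]
    simp [simplexBarycenter, hd]
  · rw [direction_sumOneHyperplane hd, Submodule.mem_orthogonal_singleton_iff_inner_right] at hw
    simpa using hw

lemma single_mem_euclideanStdSimplex {d : ℕ} (i : Fin d) :
    EuclideanSpace.single i 1 ∈ euclideanStdSimplex d := by
  refine ⟨fun j => ?_, by simp⟩
  by_cases h : j = i <;> simp [h]

lemma euclideanStdSimplex_subset_simplexOuterEllipsoid (d : ℕ) :
    euclideanStdSimplex d ⊆ simplexOuterEllipsoid d := by
  rintro s ⟨hnonneg, hsum⟩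
  refine ⟨hsum, hsum ▸ Finset.sum_le_sum fun i _ => ?_⟩
  have hle : s i ≤ 1 := hsum ▸ Finset.single_le_sum (fun j _ => hnonneg j) (Finset.mem_univ i)
  nlinarith [hnonneg i]

/-- The outer ellipsoid is the ball about the barycentre of radius `√((d - 1) / d)`. -/
lemma simplexOuterEllipsoid_eq_image {d : ℕ} (hd : d ≠ 0) {r : ℝ} (hr : 0 < r)
    (hrd : d * r ^ 2 = d - 1) :
    simplexOuterEllipsoid d = (fun v : (sumOneHyperplane d).direction =>
      simplexBarycenter d + ((r • v : (sumOneHyperplane d).direction) :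
        EuclideanSpace ℝ (Fin d))) '' Metric.closedBall 0 1 := by
  have hd' : (d : ℝ) ≠ 0 := Nat.cast_ne_zero.2 hd
  have hr2 : r ^ 2 = 1 - (d : ℝ)⁻¹ := by
    field_simp
    linarith
  -- Pythagoras: a direction `v` of the hyperplane is orthogonal to the barycentre.
  have key (v : EuclideanSpace ℝ (Fin d)) (hv : ∑ i, v i = 0) :
      ∑ i, ((simplexBarycenter d + v) i) ^ 2 = (d : ℝ)⁻¹ + ‖v‖ ^ 2 := by
    simp only [simplexBarycenter, PiLp.add_apply, add_sq, Finset.sum_add_distrib,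
      ← Finset.mul_sum, hv, EuclideanSpace.real_norm_sq_eq]
    simp
    field_simp
  ext s
  simp only [Set.mem_image, mem_closedBall_zero_iff]
  constructor
  · rintro ⟨hsum, hsq⟩
    have hmem : s - simplexBarycenter d ∈ (sumOneHyperplane d).direction :=
      AffineSubspace.vsub_mem_direction hsum (simplexBarycenter_mem hd)
    have h := key _ ((mem_direction_sumOneHyperplane hd).1 hmem)
    rw [add_sub_cancel] at h
    refine ⟨r⁻¹ • ⟨_, hmem⟩, ?_, ?_⟩
    · rw [norm_smul, Real.norm_of_nonneg (inv_nonneg.2 hr.le), inv_mul_le_one₀ hr,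
        ← sq_le_sq₀ (norm_nonneg _) hr.le, Submodule.coe_norm]
      change ‖s - simplexBarycenter d‖ ^ 2 ≤ r ^ 2
      linarith
    · simp [smul_inv_smul₀ hr.ne']
  · rintro ⟨v, hv, rfl⟩
    have hsum := (mem_direction_sumOneHyperplane hd).1 (r • v).2
    refine ⟨?_, ?_⟩
    · exact mem_sumOneHyperplane.1 (by
        rw [add_comm]
        exact AffineSubspace.vadd_mem_of_mem_direction (r • v).2 (simplexBarycenter_mem hd))
    · rw [key _ hsum, ← Submodule.coe_norm, norm_smul, Real.norm_of_nonneg hr.le, mul_pow, hr2]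
      have h1 : ‖v‖ ^ 2 ≤ 1 := pow_le_one₀ (norm_nonneg v) hv
      have h2 : 0 ≤ 1 - (d : ℝ)⁻¹ := hr2 ▸ sq_nonneg r
      nlinarith

/-! ### Rigidity of small covering ellipsoids -/

/-- The trace bound. With `w` the image under `S` of the offset from a centre `c` to the barycentre,
the hypothesis says `‖S (eᵢ - c)‖ ≤ 1`. Summing the squares over `i` bounds the Hilbert-Schmidt norm
of `S`: the cross terms with `w` cancel. -/
lemma trace_add_norm_sq_le {d : ℕ} (hd : d ≠ 0)
    (S : (sumOneHyperplane d).direction →ₗ[ℝ] (sumOneHyperplane d).direction)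
    (w : (sumOneHyperplane d).direction)
    (h : ∀ i, ‖S ((sumOneHyperplane d).direction.orthogonalProjectionOnto
      (EuclideanSpace.single i 1)) + w‖ ≤ 1) :
    LinearMap.trace ℝ _ (S.adjoint ∘ₗ S) + d * ‖w‖ ^ 2 ≤ d := by
  set u : Fin d → (sumOneHyperplane d).direction := fun i =>
    (sumOneHyperplane d).direction.orthogonalProjectionOnto (EuclideanSpace.single i 1) with hu
  have hu0 : ∑ i, u i = 0 := by
    ext j
    have hcoe (i : Fin d) : ((u i : (sumOneHyperplane d).direction) :
        EuclideanSpace ℝ (Fin d)) = EuclideanSpace.single i 1 - simplexBarycenter d :=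
      orthogonalProjection_single_eq hd i
    have hd' : (d : ℝ) ≠ 0 := Nat.cast_ne_zero.2 hd
    simp [hcoe, simplexBarycenter, hd', Pi.single_apply]
  have hcross : ∑ i, inner ℝ (S (u i)) w = 0 := by
    rw [← sum_inner, ← map_sum, hu0, map_zero, inner_zero_left]
  have htr := sum_norm_sq_apply_orthogonalProjection_eq_trace
    (EuclideanSpace.basisFun (Fin d) ℝ) (sumOneHyperplane d).direction S
  simp only [EuclideanSpace.basisFun_apply] at htr
  calc _ = ∑ i, ‖S (u i) + w‖ ^ 2 := by
        simp only [norm_add_sq_real, Finset.sum_add_distrib, ← Finset.mul_sum, hcross]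
        rw [htr]
        simp
    _ ≤ ∑ _i : Fin d, (1 : ℝ) :=
        Finset.sum_le_sum fun i _ => pow_le_one₀ (norm_nonneg _) (h i)
    _ = d := by simp

/-- A covering ellipsoid whose volume does not exceed that of the outer ellipsoid is the outer
ellipsoid; both minimality and uniqueness follow from this. -/
lemma eq_simplexOuterEllipsoid_of_volumeIn_le {d : ℕ} (hd : d ≠ 0) {r : ℝ} (hr : 0 < r)
    (hrd : d * r ^ 2 = d - 1) {F : Set (EuclideanSpace ℝ (Fin d))}
    (hF : IsCoveringEllipsoid (sumOneHyperplane d) (euclideanStdSimplex d) F)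
    (hvol : volumeIn (sumOneHyperplane d) F ≤
      volumeIn (sumOneHyperplane d) (simplexOuterEllipsoid d)) :
    F = simplexOuterEllipsoid d := by
  obtain ⟨⟨c, hc, T, rfl⟩, hcover⟩ := hF
  have hE := simplexOuterEllipsoid_eq_image hd hr hrd
  rw [hE] at hvol ⊢
  replace hvol : |LinearMap.det T.toLinearMap| ≤
      |LinearMap.det (r • LinearMap.id : (sumOneHyperplane d).direction →ₗ[ℝ] _)| :=
    (volumeIn_image_closedBall_le_iff (sumOneHyperplane d) c (simplexBarycenter d)
      T.toLinearMap (r • LinearMap.id)).1 hvol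
  have hd0 : (0 : ℝ) < d := Nat.cast_pos.2 hd.bot_lt
  -- The offset of the centre `c` from the barycentre.
  let z : (sumOneHyperplane d).direction := ⟨simplexBarycenter d - c,
    AffineSubspace.vsub_mem_direction (simplexBarycenter_mem hd) hc⟩
  have htr := trace_add_norm_sq_le hd T.symm.toLinearMap (T.symm z) fun i => by
    obtain ⟨v, hv, hvi⟩ := hcover (single_mem_euclideanStdSimplex i)
    have hTv :
        (sumOneHyperplane d).direction.orthogonalProjectionOnto (EuclideanSpace.single i 1) + z =
          T v := by
      ext1
      rw [Submodule.coe_add, orthogonalProjection_single_eq hd, ← hvi]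
      simp [z]
    rw [LinearEquiv.coe_coe, ← map_add, hTv, LinearEquiv.symm_apply_apply]
    simpa using hv
  obtain ⟨hz, hnorm⟩ := eq_zero_and_norm_smul_symm_apply_eq T hr hd0
    (hrd.trans (finrank_direction_sumOneHyperplane hd).symm) hvol htr
  have hcb : c = simplexBarycenter d :=
    (sub_eq_zero.1 (congrArg Subtype.val hz : simplexBarycenter d - c = 0)).symm
  subst hcb
  refine Set.Subset.antisymm ?_ ?_
  · rintro _ ⟨v, hv, rfl⟩
    refine ⟨r⁻¹ • T v, ?_, by simp [smul_inv_smul₀ hr.ne']⟩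
    rw [mem_closedBall_zero_iff] at hv ⊢
    rwa [← hnorm, map_smul, smul_inv_smul₀ hr.ne', LinearEquiv.symm_apply_apply]
  · rintro _ ⟨v, hv, rfl⟩
    refine ⟨r • T.symm v, ?_, by simp⟩
    rw [mem_closedBall_zero_iff] at hv ⊢
    rwa [hnorm]

/-! ### The zero-dimensional case -/

lemma subsingleton_sumOneHyperplane_one :
    (sumOneHyperplane 1 : Set (EuclideanSpace ℝ (Fin 1))).Subsingleton := by
  intro s hs t ht
  have hs' := mem_sumOneHyperplane.1 hs
  have ht' := mem_sumOneHyperplane.1 ht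
  simp only [Finset.univ_unique, Finset.sum_singleton] at hs' ht'
  ext i
  rw [Subsingleton.elim i default, hs', ht']

/-- In dimension zero the hyperplane is a point, which is its only covering ellipsoid. -/
lemma eq_simplexOuterEllipsoid_one {F : Set (EuclideanSpace ℝ (Fin 1))}
    (hF : IsCoveringEllipsoid (sumOneHyperplane 1) (euclideanStdSimplex 1) F) :
    F = simplexOuterEllipsoid 1 := by
  have hmem := single_mem_euclideanStdSimplex (0 : Fin 1)
  refine (subsingleton_sumOneHyperplane_one.anti hF.1.subset).eq_singleton_of_mem
    (hF.2 hmem) |>.trans ?_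
  exact ((subsingleton_sumOneHyperplane_one.anti fun s hs => hs.1).eq_singleton_of_mem
    (euclideanStdSimplex_subset_simplexOuterEllipsoid 1 hmem)).symm

/-- The unit ball about the barycentre is an ellipsoid of the one-point hyperplane, hence equal to
the outer ellipsoid. The radius `√((d - 1) / d)` vanishes here, so `simplexOuterEllipsoid_eq_image`
does not apply. -/
lemma isEllipsoidIn_simplexOuterEllipsoid_one :
    IsEllipsoidIn (sumOneHyperplane 1) (simplexOuterEllipsoid 1) := by
  have hell : IsEllipsoidIn (sumOneHyperplane 1) _ :=
    ⟨_, simplexBarycenter_mem one_ne_zero, LinearEquiv.refl ℝ _, rfl⟩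
  convert hell
  refine (eq_simplexOuterEllipsoid_one ⟨hell, fun s hs => ?_⟩).symm
  refine ⟨0, by simp, ?_⟩
  exact subsingleton_sumOneHyperplane_one
    (by simpa using simplexBarycenter_mem one_ne_zero) hs.2

lemma isEllipsoidIn_simplexOuterEllipsoid {d : ℕ} (hd : d ≠ 0) {r : ℝ} (hr : 0 < r)
    (hrd : d * r ^ 2 = d - 1) :
    IsEllipsoidIn (sumOneHyperplane d) (simplexOuterEllipsoid d) :=
  ⟨_, simplexBarycenter_mem hd, LinearEquiv.smulOfNeZero ℝ _ r hr.ne',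
    simplexOuterEllipsoid_eq_image hd hr hrd⟩

/-! ### Minimality and uniqueness -/

theorem mainTheorem6 (d : ℕ) (hd : 1 ≤ d) :
    IsMinVolumeCoveringEllipsoid (sumOneHyperplane d) (euclideanStdSimplex d)
        (simplexOuterEllipsoid d) ∧
      ∀ F : Set (EuclideanSpace ℝ (Fin d)),
        IsMinVolumeCoveringEllipsoid (sumOneHyperplane d) (euclideanStdSimplex d) F →
          F = simplexOuterEllipsoid d := by
  -- Applied to `F` of strictly smaller volume, the rigidity statement gives minimality; applied to
  -- a minimiser `F`, it gives uniqueness.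
  suffices h : IsEllipsoidIn (sumOneHyperplane d) (simplexOuterEllipsoid d) ∧
      ∀ F, IsCoveringEllipsoid (sumOneHyperplane d) (euclideanStdSimplex d) F →
        volumeIn (sumOneHyperplane d) F ≤
          volumeIn (sumOneHyperplane d) (simplexOuterEllipsoid d) →
        F = simplexOuterEllipsoid d by
    have hE : IsCoveringEllipsoid (sumOneHyperplane d) (euclideanStdSimplex d)
        (simplexOuterEllipsoid d) := ⟨h.1, euclideanStdSimplex_subset_simplexOuterEllipsoid d⟩
    refine ⟨⟨hE, fun F hF => ?_⟩, fun F hF => h.2 F hF.1 (hF.2 _ hE)⟩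
    by_contra hlt
    rw [h.2 F hF (not_le.1 hlt).le] at hlt
    exact hlt le_rfl
  obtain rfl | hd2 := hd.eq_or_lt
  · exact ⟨isEllipsoidIn_simplexOuterEllipsoid_one, fun F hF _ => eq_simplexOuterEllipsoid_one hF⟩
  · have hd0 : d ≠ 0 := by omega
    have hd1 : (1 : ℝ) < d := by exact_mod_cast hd2
    have hq : 0 < ((d : ℝ) - 1) / d := div_pos (by linarith) (by linarith)
    have hrd : d * √(((d : ℝ) - 1) / d) ^ 2 = d - 1 := by
      rw [Real.sq_sqrt hq.le]
      field_simp
    have hr := Real.sqrt_pos.2 hq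
    exact ⟨isEllipsoidIn_simplexOuterEllipsoid hd0 hr hrd,
      fun F hF hvol => eq_simplexOuterEllipsoid_of_volumeIn_le hd0 hr hrd hF hvol⟩
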